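/- Let $X\in\mathbb{R}^{N\times d}$ have rank $r$ and let $X=U\Sigma V^{T}$ be a thin singular value decomposition: $U\in\mathbb{R}^{N\times r}$ and $V\in\mathbb{R}^{d\times r}$ have orthonormal columns and $\Sigma=\mathrm{diag}(\sigma_1,\dots,\sigma_r)$ with $\sigma_1\ge\dots\ge\sigma_r>0$; put $\sigma_j=0$ for $j>r$. Let $1\le k\le r$ and let $V_k\in\mathbb{R}^{d\times k}$ consist of the first $k$ columns of $V$. The $k$-leverage score of $j\in[d]=\{1,\dots,d\}$ is $\ell^k_j=\sum_{i=1}^k V_{j,i}^2$. Let $S$ be a random subset of $[d]$ of size $k$ drawn from the projection DPP of marginal kernel $V_kV_k^{T}$, i.e. $\mathbb{P}_{\mathrm{DPP}}(S)=\det(V_{S,[k]})^2$ for $|S|=k$, where $V_{S,[k]}$ is the submatrix of $V_k$ of the rows indexed by $S$. Let $\|\cdot\|_2$ and $\|\cdot\|_{\mathrm{Fr}}$ be the spectral and Frobenius norms. For $\nu\in\{2,\mathrm{Fr}\}$, let $\Pi_S^{\nu}X$ be a minimizer of $\|X-A\|_\nu$ over the matrices $A=X_{:,S}B$ with $B\in\mathbb{R}^{k\times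 d}$, and let $\Pi_kX$ be a best approximation of $X$ of rank at most $k$ in the norm $\|\cdot\|_\nu$ under consideration. Let $$\beta=\sigma_{k+1}^2\Big(\frac1{d-k}\sum_{j\ge k+1}\sigma_j^2\Big)^{-1}.$$ **Theorem.** Let $\pi$ be a permutation of $[d]$ with $\ell^k_{\pi_1}\ge\ell^k_{\pi_2}\ge\dots\ge\ell^k_{\pi_d}$. Let $\theta>1$, $$p_{\mathrm{eff}}(\theta)=\min\Big\{q\in[d]:\ \sum_{i\le q}\ell^k_{\pi_i}\ \ge\ k-1+\frac1\theta\Big\},$$ and let $\mathcal{A}_\theta$ be the event that $S\cap\{\pi_i:\ p_{\mathrm{eff}}(\theta)<i\le d\}=\emptyset$. Then $$\mathbb{P}_{\mathrm{DPP}}(\mathcal{A}_\theta)\ \ge\ \frac1\theta,$$ $$\mathbb{E}_{\mathrm{DPP}}\big[\|X-\Pi_S^{2}X\|_2^2\,\big|\,\mathcal{A}_\theta\big]\ \le\ (p_{\mathrm{eff}}(\theta)-k+1)(k-1+\theta)\,\|X-\Pi_kX\|_2^2,$$ $$\mathbb{E}_{\mathrm{DPP}}\big[\|X-\Pi_S^{\mathrm{Fr}}X\|_{\mathrm{Fr}}^2\,\big|\,\mathcal{A}_\theta\big]\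 \le\ \Big(1+\beta\,\frac{p_{\mathrm{eff}}(\theta)+1-k}{d-k}\,(k-1+\theta)\Big)\|X-\Pi_kX\|_{\mathrm{Fr}}^2.$$ In the degenerate case $r=k$, where $\sigma_{k+1}=0$ and $\beta$ is a quotient $0/0$, the term containing $\beta$ is read as $0$ (both sides of the last bound are then $0$). -/

import Mathlib

open MeasureTheory
open scoped Matrix

noncomputable section

namespace ColumnSubset

/-- Thin singular value decomposition `X = U Σ Vᵀ`: `U` and `V` have orthonormal columns and the
singular values `σ 0 ≥ σ 1 ≥ ... ≥ σ (r - 1)` are positive, so that `r` is the rank of `X`. -/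
structure IsThinSVD {N d r : ℕ} (X : Matrix (Fin N) (Fin d) ℝ) (U : Matrix (Fin N) (Fin r) ℝ)
    (σ : Fin r → ℝ) (V : Matrix (Fin d) (Fin r) ℝ) : Prop where
  orthU : Uᵀ * U = 1
  orthV : Vᵀ * V = 1
  pos : ∀ i, 0 < σ i
  anti : Antitone σ
  eq : X = U * Matrix.diagonal σ * Vᵀ

/-- The first `k` columns of a matrix with `r ≥ k` columns. -/
def firstCols {d r k : ℕ} (hk : k ≤ r) (V : Matrix (Fin d) (Fin r) ℝ) :
    Matrix (Fin d) (Fin k) ℝ :=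
  V.submatrix id (Fin.castLE hk)

/-- The two matrix norms under consideration. -/
inductive NormKind
  | spectral
  | frobenius

open scoped Matrix.Norms.L2Operator in
/-- The spectral norm: the operator norm between Euclidean spaces. -/
def spectralNorm {N d : ℕ} (A : Matrix (Fin N) (Fin d) ℝ) : ℝ := ‖A‖

open scoped Matrix.Norms.Frobenius in
/-- The Frobenius norm. -/
def frobeniusNorm {N d : ℕ} (A : Matrix (Fin N) (Fin d) ℝ) : ℝ := ‖A‖

/-- The norm `‖A‖_ν`. -/
def matNorm {N d : ℕ} (ν : NormKind) (A : Matrix (Fin N) (Fin d) ℝ) : ℝ :=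
  match ν with
  | .spectral => spectralNorm A
  | .frobenius => frobeniusNorm A

/-- `A` is a point of `C` that is closest to `X` in the norm `‖·‖_ν`. -/
def IsNearest {N d : ℕ} (ν : NormKind) (C : Set (Matrix (Fin N) (Fin d) ℝ))
    (X A : Matrix (Fin N) (Fin d) ℝ) : Prop :=
  A ∈ C ∧ ∀ B ∈ C, matNorm ν (X - A) ≤ matNorm ν (X - B)

theorem exists_nearest_aux {E : Type*} [NormedAddCommGroup E] [NormedSpace ℝ E]
    [FiniteDimensional ℝ E] {C : Set E} (hC : IsClosed C) (hne : C.Nonempty) (x : E) :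
    ∃ a ∈ C, ∀ b ∈ C, ‖x - a‖ ≤ ‖x - b‖ := by
  have : ProperSpace E := FiniteDimensional.proper ℝ E
  obtain ⟨a, ha, h⟩ := hC.exists_infDist_eq_dist hne x
  refine ⟨a, ha, fun b hb => ?_⟩
  rw [← dist_eq_norm, ← dist_eq_norm, ← h]
  exact Metric.infDist_le_dist_of_mem hb

theorem exists_isNearest {N d : ℕ} (ν : NormKind) {C : Set (Matrix (Fin N) (Fin d) ℝ)}
    (hC : IsClosed C) (hne : C.Nonempty) (X : Matrix (Fin N) (Fin d) ℝ) :
    ∃ A, IsNearest ν C X A := by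
  cases ν with
  | spectral =>
    open scoped Matrix.Norms.L2Operator in
    obtain ⟨a, ha, h⟩ := exists_nearest_aux hC hne X
    exact ⟨a, ha, h⟩
  | frobenius =>
    open scoped Matrix.Norms.Frobenius in
    obtain ⟨a, ha, h⟩ := exists_nearest_aux hC hne X
    exact ⟨a, ha, h⟩

/-- The matrices of rank at most `k`. -/
def rankLE (N d k : ℕ) : Set (Matrix (Fin N) (Fin d) ℝ) := {A | A.rank ≤ k}

/-- The matrices whose columns lie in the span of the columns of `X` indexed by `S`, that is the
matrices `X_{:,S} B`. When `S` has `k` elements they automatically have rank at most `k`. -/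
def colSpan {N d : ℕ} (X : Matrix (Fin N) (Fin d) ℝ) (S : Finset (Fin d)) :
    Set (Matrix (Fin N) (Fin d) ℝ) :=
  Set.range fun B : Matrix S (Fin d) ℝ => X.submatrix id (Subtype.val : S → Fin d) * B

theorem isClosed_rankLE (N d k : ℕ) : IsClosed (rankLE N d k) := by
  have h := (isOpen_setOfPred_nat_le_rank (𝕜 := ℝ) (E := Fin d → ℝ) (F := Fin N → ℝ)
    (k + 1)).isClosed_compl
  have hc : Continuous fun A : Matrix (Fin N) (Fin d) ℝ =>
      LinearMap.toContinuousLinearMap (Matrix.toLin' A) :=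
    ((Matrix.toLin' (R := ℝ) (m := Fin N) (n := Fin d)).trans
      LinearMap.toContinuousLinearMap).toLinearMap.continuous_of_finiteDimensional
  convert h.preimage hc using 1
  ext A
  have hA : LinearMap.rank (Matrix.toLin' A) = (A.rank : Cardinal) := by
    rw [Matrix.rank, ← Matrix.toLin'_apply', LinearMap.rank, Module.finrank_eq_rank]
  change A.rank ≤ k ↔ ¬ (((k + 1 : ℕ) : Cardinal) ≤ LinearMap.rank (Matrix.toLin' A))
  rw [hA, Nat.cast_le]
  omega

theorem exists_bestRank {N d : ℕ} (ν : NormKind) (k : ℕ) (X : Matrix (Fin N) (Fin d) ℝ) :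
    ∃ A, IsNearest ν (rankLE N d k) X A :=
  exists_isNearest ν (isClosed_rankLE N d k) ⟨0, by simp [rankLE]⟩ X

theorem exists_colProj {N d : ℕ} (ν : NormKind) (X : Matrix (Fin N) (Fin d) ℝ)
    (S : Finset (Fin d)) : ∃ A, IsNearest ν (colSpan X S) X A := by
  refine exists_isNearest ν ?_ (Set.range_nonempty _) X
  exact (LinearMap.range (mulLeftLinearMap (Fin d) ℝ
    (X.submatrix id (Subtype.val : S → Fin d)))).closed_of_finiteDimensional

/-- `Π_k X`: a best approximation of `X` of rank at most `k` in the norm `‖·‖_ν`. -/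
def bestRank {N d : ℕ} (ν : NormKind) (k : ℕ) (X : Matrix (Fin N) (Fin d) ℝ) :
    Matrix (Fin N) (Fin d) ℝ :=
  (exists_bestRank ν k X).choose

/-- `Π_S^ν X`: a best approximation of `X` in the norm `‖·‖_ν` among the matrices whose columns
lie in the span of the columns of `X` indexed by `S`. -/
def colProj {N d : ℕ} (ν : NormKind) (X : Matrix (Fin N) (Fin d) ℝ) (S : Finset (Fin d)) :
    Matrix (Fin N) (Fin d) ℝ :=
  (exists_colProj ν X S).choose

/-- `Det(V_{S,[k]})²` if `S` has `k` elements, and `0` otherwise. -/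
def dppWeight {d k : ℕ} (Vk : Matrix (Fin d) (Fin k) ℝ) (S : Finset (Fin d)) : ℝ :=
  if h : S.card = k then (Vk.submatrix (S.orderEmbOfFin h) id).det ^ 2 else 0

/-- The law of the random set of column indices: `S` has probability `Det(V_{S,[k]})²` if
`|S| = k`, and `0` otherwise. -/
def dpp {d k : ℕ} (Vk : Matrix (Fin d) (Fin k) ℝ) : Measure (Finset (Fin d)) :=
  ∑ S : Finset (Fin d), ENNReal.ofReal (dppWeight Vk S) • Measure.dirac S

theorem dppWeight_nonneg {d k : ℕ} (Vk : Matrix (Fin d) (Fin k) ℝ) (S : Finset (Fin d)) :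
    0 ≤ dppWeight Vk S := by
  unfold dppWeight
  split_ifs
  · positivity
  · exact le_rfl

/-- The weights sum to `Det(Vₖᵀ Vₖ)`. -/
theorem sum_dppWeight {d k : ℕ} (Vk : Matrix (Fin d) (Fin k) ℝ) :
    ∑ S : Finset (Fin d), dppWeight Vk S = (Vkᵀ * Vk).det := by
  have h1 : (Vkᵀ * Vk).det =
      ∑ f : Fin k → Fin d, (∏ i, Vk (f i) i) * (Vk.submatrix f id).det := by
    rw [← Matrix.det_transpose, Matrix.det_apply']
    simp only [Matrix.transpose_apply, Matrix.mul_apply, Finset.prod_univ_sum,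
      Fintype.piFinset_univ, Finset.mul_sum]
    rw [Finset.sum_comm]
    refine Finset.sum_congr rfl fun f _ => ?_
    rw [← Matrix.det_transpose, Matrix.det_apply', Finset.mul_sum]
    refine Finset.sum_congr rfl fun τ _ => ?_
    simp only [Finset.prod_mul_distrib, Matrix.transpose_apply, Matrix.submatrix_apply, id]
    ring
  rw [h1]
  have h2 : ∑ S : Finset (Fin d), dppWeight Vk S =
      ∑ S : {S : Finset (Fin d) // S.card = k}, dppWeight Vk S.1 := by
    symm
    refine Fintype.sum_of_injective (fun S => S.1) Subtype.val_injective _ _ ?_ fun _ => rfl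
    intro S hS
    unfold dppWeight
    rw [dif_neg]
    exact fun h => hS ⟨⟨S, h⟩, rfl⟩
  have h3 : ∀ S : {S : Finset (Fin d) // S.card = k}, dppWeight Vk S.1 =
      ∑ τ : Equiv.Perm (Fin k), (∏ i, Vk (S.1.orderEmbOfFin S.2 (τ i)) i) *
        (Vk.submatrix (fun i => S.1.orderEmbOfFin S.2 (τ i)) id).det := by
    intro S
    have h4 : ∀ τ : Equiv.Perm (Fin k),
        (Vk.submatrix (fun i => S.1.orderEmbOfFin S.2 (τ i)) id).det =
          (Equiv.Perm.sign τ : ℤ) * (Vk.submatrix (S.1.orderEmbOfFin S.2) id).det := by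
      intro τ
      rw [← Matrix.det_permute]
      rfl
    simp only [h4]
    rw [dppWeight, dif_pos S.2, sq]
    nth_rewrite 1 [Matrix.det_apply']
    rw [Finset.sum_mul]
    refine Finset.sum_congr rfl fun τ _ => ?_
    simp only [Matrix.submatrix_apply, id]
    ring
  rw [h2, Finset.sum_congr rfl fun S _ => h3 S, ← Fintype.sum_prod_type'
    (f := fun (S : {S : Finset (Fin d) // S.card = k}) (τ : Equiv.Perm (Fin k)) =>
      (∏ i, Vk (S.1.orderEmbOfFin S.2 (τ i)) i) *
        (Vk.submatrix (fun i => S.1.orderEmbOfFin S.2 (τ i)) id).det)]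
  refine Fintype.sum_of_injective
    (fun p : {S : Finset (Fin d) // S.card = k} × Equiv.Perm (Fin k) =>
      fun i => p.1.1.orderEmbOfFin p.1.2 (p.2 i)) ?_ _ _ ?_ fun _ => rfl
  · rintro ⟨S, τ⟩ ⟨S', τ'⟩ h
    have hr : ∀ (T : {S : Finset (Fin d) // S.card = k}) (ρ : Equiv.Perm (Fin k)),
        Set.range (fun i => T.1.orderEmbOfFin T.2 (ρ i)) = (T.1 : Set (Fin d)) := by
      intro T ρ
      rw [← Finset.range_orderEmbOfFin T.1 T.2]
      exact ρ.surjective.range_comp (T.1.orderEmbOfFin T.2)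
    have hS : S = S' := by
      apply Subtype.ext
      apply Finset.coe_injective
      rw [← hr S τ, ← hr S' τ']
      exact congrArg Set.range h
    subst hS
    refine Prod.ext rfl (Equiv.ext fun i => ?_)
    exact (S.1.orderEmbOfFin S.2).injective (congrFun h i)
  · intro f hf
    by_cases hinj : Function.Injective f
    · exfalso
      apply hf
      have hcard : (Finset.univ.image f).card = k := by
        rw [Finset.card_image_of_injective _ hinj, Finset.card_univ, Fintype.card_fin]
      have hmem : ∀ i, f i ∈ Finset.univ.image f :=
        fun i => Finset.mem_image_of_mem f (Finset.mem_univ i)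
      let g : Fin k → Fin k :=
        fun i => ((Finset.univ.image f).orderIsoOfFin hcard).symm ⟨f i, hmem i⟩
      have hg : ∀ i, (Finset.univ.image f).orderEmbOfFin hcard (g i) = f i := by
        intro i
        rw [← Finset.coe_orderIsoOfFin_apply]
        simp [g]
      have hginj : Function.Injective g := by
        intro i j hij
        apply hinj
        rw [← hg i, ← hg j, hij]
      refine ⟨(⟨_, hcard⟩, Equiv.ofBijective g (Finite.injective_iff_bijective.1 hginj)), ?_⟩
      funext i
      exact hg i
    · simp only [Function.Injective, not_forall] at hinj
      obtain ⟨i, j, hij, hne⟩ := hinj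
      rw [Matrix.det_zero_of_row_eq hne, mul_zero]
      funext l
      simp [hij]

theorem isProbabilityMeasure_dpp {d k : ℕ} {Vk : Matrix (Fin d) (Fin k) ℝ} (h : Vkᵀ * Vk = 1) :
    IsProbabilityMeasure (dpp Vk) := by
  constructor
  simp only [dpp, Measure.coe_finsetSum, Finset.sum_apply, Measure.smul_apply, measure_univ,
    smul_eq_mul, mul_one]
  rw [← ENNReal.ofReal_sum_of_nonneg fun S _ => dppWeight_nonneg Vk S, sum_dppWeight, h]
  simp

theorem firstCols_orth {d r k : ℕ} (hk : k ≤ r) {V : Matrix (Fin d) (Fin r) ℝ}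
    (h : Vᵀ * V = 1) : (firstCols hk V)ᵀ * firstCols hk V = 1 := by
  ext i j
  have := congrFun (congrFun h (Fin.castLE hk i)) (Fin.castLE hk j)
  simpa [firstCols, Matrix.mul_apply, Matrix.one_apply] using this

/-- The `k`-leverage score of the `j`-th column: the squared norm of the `j`-th row of `Vₖ`. -/
def leverage {d k : ℕ} (Vk : Matrix (Fin d) (Fin k) ℝ) (j : Fin d) : ℝ :=
  ∑ i : Fin k, Vk j i ^ 2

/-- The effective sparsity level: the least `q ∈ {1, ..., d}` such that the first `q` leverage
scores, in the order given by `π`, sum to at least `k - 1 + 1/θ`. -/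
def pEff {d k : ℕ} (Vk : Matrix (Fin d) (Fin k) ℝ) (π : Equiv.Perm (Fin d)) (θ : ℝ) : ℕ :=
  sInf {q : ℕ | 1 ≤ q ∧ q ≤ d ∧
    (k : ℝ) - 1 + 1 / θ ≤ ∑ i : Fin d with i.val < q, leverage Vk (π i)}

/-- The indices that come after the first `q` ones in the order given by `π`. -/
def tailSet {d : ℕ} (π : Equiv.Perm (Fin d)) (q : ℕ) : Finset (Fin d) :=
  (Finset.univ.filter fun i : Fin d => q ≤ i.val).image π

/-- The event that `S` contains none of the indices that come after the first `p_eff(θ)` ones. -/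
def avoidEvent {d k : ℕ} (Vk : Matrix (Fin d) (Fin k) ℝ) (π : Equiv.Perm (Fin d)) (θ : ℝ) :
    Set (Finset (Fin d)) :=
  {S | S ∩ tailSet π (pEff Vk π θ) = ∅}

/-- The flatness parameter `β = σ_{k+1}² ((1/(d-k)) ∑_{j ≥ k+1} σ_j²)⁻¹` of the singular values
`σ_1 ≥ ... ≥ σ_r`, here `σ 0, ..., σ (r - 1)`, where `σ_j = 0` for `j > r`. If `σ_{k+1} = 0`,
then it takes the value `0`. -/
def flatness {r : ℕ} (d k : ℕ) (σ : Fin r → ℝ) : ℝ :=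
  (if h : k < r then σ ⟨k, h⟩ ^ 2 else 0) *
    (1 / ((d : ℝ) - k) * ∑ j : Fin r with k ≤ j.val, σ j ^ 2)⁻¹

end ColumnSubset

end

open ColumnSubset

/-
Write `V` for the first `k` right singular vectors, `v j` for its rows, and
`G = ∑ j ∈ A, v j (v j)ᵀ`, where `A` is the set of indices that `S` is conditioned to stay in.
By Cauchy-Binet, `ℙ(S ⊆ A) = det G`. The eigenvalues `λ i` of `G` lie in `[0, 1]` and the
hypothesis on the leverage scores says `∑ i, (1 - λ i) ≤ 1 - 1/θ`, so `det G ≥ 1/θ`.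

For `S` of positive weight let `C` be `(V_S)⁻ᵀ` padded with zero rows outside `S`, so `Vᵀ C = 1`.
The columns of `X C Vᵀ` lie in the span of those of `X_S`, and `X - X C Vᵀ = E - E C Vᵀ` with
`E = X - X V Vᵀ`, which has the optimal norm by Eckart-Young. As `E V = 0`, the two terms are
orthogonal, so the error of `S` is governed by the norms of `E` and `C`. The determinant in the law
of `S` cancels the inverse: `det(V_S)² ‖C‖² = ‖adj V_S‖²` is a sum of squared minors of order
`k - 1`. Summed over `S ⊆ A`, each minor occurs `#A - k + 1` times, which gives
`(#A - k + 1) tr (adj G)`, and `tr (adj G) = ∑ i, ∏ l ≠ i, λ l ≤ (k - 1 + θ) det G`.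
-/

namespace ColumnSubset

section Norms

open Matrix

variable {N m d : ℕ}

theorem frobeniusNorm_nonneg (A : Matrix (Fin N) (Fin d) ℝ) : 0 ≤ frobeniusNorm A := by
  open scoped Matrix.Norms.Frobenius in
  exact norm_nonneg A

theorem frobeniusNorm_sq (A : Matrix (Fin N) (Fin d) ℝ) :
    frobeniusNorm A ^ 2 = ∑ i, ∑ j, A i j ^ 2 := by
  rw [frobeniusNorm, frobenius_norm_def, ← Real.sqrt_eq_rpow, Real.sq_sqrt (by positivity)]
  simp

theorem frobeniusNorm_sq_eq_trace (A : Matrix (Fin N) (Fin d) ℝ) :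
    frobeniusNorm A ^ 2 = (A * Aᵀ).trace := by
  rw [frobeniusNorm_sq]
  simp [trace, mul_apply, sq]

theorem frobeniusNorm_transpose (A : Matrix (Fin N) (Fin d) ℝ) :
    frobeniusNorm Aᵀ = frobeniusNorm A :=
  frobenius_norm_transpose A

theorem spectralNorm_nonneg (A : Matrix (Fin N) (Fin d) ℝ) : 0 ≤ spectralNorm A := by
  open scoped Matrix.Norms.L2Operator in
  exact norm_nonneg A

theorem spectralNorm_add_le (A B : Matrix (Fin N) (Fin d) ℝ) :
    spectralNorm (A + B) ≤ spectralNorm A + spectralNorm B := by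
  open scoped Matrix.Norms.L2Operator in
  exact norm_add_le A B

theorem spectralNorm_mul_le (A : Matrix (Fin N) (Fin m) ℝ) (B : Matrix (Fin m) (Fin d) ℝ) :
    spectralNorm (A * B) ≤ spectralNorm A * spectralNorm B :=
  l2_opNorm_mul A B

theorem spectralNorm_transpose (A : Matrix (Fin N) (Fin d) ℝ) :
    spectralNorm Aᵀ = spectralNorm A := by
  rw [← conjTranspose_eq_transpose_of_trivial]
  exact l2_opNorm_conjTranspose A

theorem spectralNorm_transpose_mul_self (A : Matrix (Fin N) (Fin d) ℝ) :
    spectralNorm (Aᵀ * A) = spectralNorm A ^ 2 := by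
  rw [← conjTranspose_eq_transpose_of_trivial, sq]
  exact l2_opNorm_conjTranspose_mul_self A

theorem spectralNorm_mul_transpose_self (A : Matrix (Fin N) (Fin d) ℝ) :
    spectralNorm (A * Aᵀ) = spectralNorm A ^ 2 := by
  rw [← spectralNorm_transpose A, ← spectralNorm_transpose_mul_self, transpose_transpose]

theorem spectralNorm_diagonal_le {v : Fin d → ℝ} {c : ℝ} (hc : 0 ≤ c) (h : ∀ i, |v i| ≤ c) :
    spectralNorm (diagonal v) ≤ c :=
  (l2_opNorm_diagonal v).trans_le ((pi_norm_le_iff_of_nonneg hc).2 h)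

theorem spectralNorm_le_one_of_transpose_mul_self_eq_one {A : Matrix (Fin N) (Fin d) ℝ}
    (h : Aᵀ * A = 1) : spectralNorm A ≤ 1 := by
  rw [← sq_le_one_iff₀ (spectralNorm_nonneg A), ← spectralNorm_transpose_mul_self, h,
    ← diagonal_one]
  exact spectralNorm_diagonal_le zero_le_one (by simp)

theorem sum_mulVec_sq_le (A : Matrix (Fin N) (Fin d) ℝ) (x : Fin d → ℝ) :
    ∑ i, (A *ᵥ x) i ^ 2 ≤ spectralNorm A ^ 2 * ∑ j, x j ^ 2 := by
  have h := pow_le_pow_left₀ (norm_nonneg _) (l2_opNorm_mulVec A (WithLp.toLp 2 x)) 2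
  simpa [mul_pow, EuclideanSpace.norm_sq_eq, spectralNorm] using h

theorem spectralNorm_le_frobeniusNorm (A : Matrix (Fin N) (Fin d) ℝ) :
    spectralNorm A ≤ frobeniusNorm A := by
  rw [spectralNorm, l2_opNorm_def]
  refine ContinuousLinearMap.opNorm_le_bound _ (frobeniusNorm_nonneg A) fun x => ?_
  open scoped Matrix.Norms.Frobenius in
  have h := frobenius_norm_mul A (replicateCol Unit x.ofLp)
  rwa [← replicateCol_mulVec, frobenius_norm_replicateCol, frobenius_norm_replicateCol] at h

theorem frobeniusNorm_mul_le_spectralNorm_mul (A : Matrix (Fin N) (Fin m) ℝ)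
    (B : Matrix (Fin m) (Fin d) ℝ) :
    frobeniusNorm (A * B) ≤ spectralNorm A * frobeniusNorm B := by
  refine le_of_sq_le_sq ?_ (mul_nonneg (spectralNorm_nonneg A) (frobeniusNorm_nonneg B))
  rw [mul_pow, frobeniusNorm_sq, frobeniusNorm_sq, Finset.sum_comm, Finset.sum_comm (γ := Fin m),
    Finset.mul_sum]
  exact Finset.sum_le_sum fun j _ => sum_mulVec_sq_le A fun i => B i j

theorem frobeniusNorm_mul_le_mul_spectralNorm (A : Matrix (Fin N) (Fin m) ℝ)
    (B : Matrix (Fin m) (Fin d) ℝ) :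
    frobeniusNorm (A * B) ≤ frobeniusNorm A * spectralNorm B := by
  rw [← frobeniusNorm_transpose, transpose_mul, mul_comm, ← spectralNorm_transpose B,
    ← frobeniusNorm_transpose A]
  exact frobeniusNorm_mul_le_spectralNorm_mul Bᵀ Aᵀ

end Norms

section RowGram

open Matrix

variable {ι κ κ' : Type*}

/-- The Gram matrix `∑_{j ∈ A} v_j v_jᵀ` of the rows `v_j` of `V` indexed by `A`. -/
def rowGram (V : Matrix ι κ ℝ) (A : Finset ι) : Matrix κ κ ℝ :=
  ∑ j ∈ A, vecMulVec (V j) (V j)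

theorem rowGram_apply (V : Matrix ι κ ℝ) (A : Finset ι) (i l : κ) :
    rowGram V A i l = ∑ j ∈ A, V j i * V j l := by
  simp [rowGram, Matrix.sum_apply, vecMulVec_apply]

theorem rowGram_submatrix (V : Matrix ι κ ℝ) (A : Finset ι) (f : κ' → κ) :
    rowGram (V.submatrix id f) A = (rowGram V A).submatrix f f := by
  ext i l
  simp [rowGram_apply]

theorem trace_rowGram [Fintype κ] (V : Matrix ι κ ℝ) (A : Finset ι) :
    (rowGram V A).trace = ∑ j ∈ A, ∑ i, V j i ^ 2 := by
  simp [rowGram, trace_sum, trace_vecMulVec, dotProduct, sq]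

theorem posSemidef_rowGram [Finite κ] (V : Matrix ι κ ℝ) (A : Finset ι) :
    (rowGram V A).PosSemidef :=
  posSemidef_sum A fun j _ => posSemidef_vecMulVec_self_star (V j)

theorem rowGram_univ [Fintype ι] (V : Matrix ι κ ℝ) : rowGram V Finset.univ = Vᵀ * V := by
  ext i l
  simp [rowGram_apply, mul_apply]

theorem posSemidef_one_sub_rowGram [Fintype ι] [Finite κ] [DecidableEq κ]
    {V : Matrix ι κ ℝ} (hV : Vᵀ * V = 1) (A : Finset ι) : (1 - rowGram V A).PosSemidef := by
  classical
  have h : 1 - rowGram V A = rowGram V Aᶜ := by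
    rw [← hV, ← rowGram_univ, sub_eq_iff_eq_add', rowGram, rowGram, rowGram,
      Finset.sum_add_sum_compl]
  exact h ▸ posSemidef_rowGram V Aᶜ

end RowGram

section Weights

open Matrix

variable {d k m : ℕ}

theorem dppWeight_diagonal_mul (w : Fin d → ℝ) (V : Matrix (Fin d) (Fin k) ℝ)
    (S : Finset (Fin d)) :
    dppWeight (diagonal w * V) S = (∏ a ∈ S, w a) ^ 2 * dppWeight V S := by
  unfold dppWeight
  split_ifs with h
  · have hsub : (diagonal w * V).submatrix (S.orderEmbOfFin h) id =
        diagonal (w ∘ S.orderEmbOfFin h) * V.submatrix (S.orderEmbOfFin h) id := by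
      ext i j
      simp
    have hprod : ∏ i, w (S.orderEmbOfFin h i) = ∏ a ∈ S, w a := by
      conv_rhs => rw [← S.map_orderEmbOfFin_univ h, Finset.prod_map]
      rfl
    rw [hsub, det_mul, det_diagonal, mul_pow, ← hprod]
    rfl
  · rw [mul_zero]

theorem det_rowGram (V : Matrix (Fin d) (Fin k) ℝ) (A : Finset (Fin d)) :
    (rowGram V A).det = ∑ S ∈ A.powerset, dppWeight V S := by
  have hgram : (diagonal (fun j => if j ∈ A then (1 : ℝ) else 0) * V)ᵀ *
      (diagonal (fun j => if j ∈ A then (1 : ℝ) else 0) * V) = rowGram V A := by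
    ext i l
    rw [mul_apply]
    simp [rowGram_apply, -transpose_mul]
  have h := sum_dppWeight (diagonal (fun j => if j ∈ A then (1 : ℝ) else 0) * V)
  rw [hgram] at h
  simpa [dppWeight_diagonal_mul, Finset.prod_boole, ← Finset.subset_iff,
    ← Finset.sum_filter, Finset.filter_subset_univ] using h.symm

/-- The quantity `det(V_S)² ‖V_S⁻¹‖_Fr²` attached to a `k`-subset `S`, with the inverse replaced by
the adjugate so that it also makes sense for singular `V_S`; it is `0` if `S` does not have `k`
elements. -/
noncomputable def adjugateWeight (V : Matrix (Fin d) (Fin k) ℝ) (S : Finset (Fin d)) : ℝ :=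
  if h : S.card = k then frobeniusNorm (V.submatrix (S.orderEmbOfFin h) id).adjugate ^ 2 else 0

theorem orderEmbOfFin_erase {α : Type*} [LinearOrder α] (S : Finset α) (h : S.card = m + 1)
    (i : Fin (m + 1)) (h' : (S.erase (S.orderEmbOfFin h i)).card = m) :
    ⇑((S.erase (S.orderEmbOfFin h i)).orderEmbOfFin h') = S.orderEmbOfFin h ∘ i.succAbove := by
  symm
  refine Finset.orderEmbOfFin_unique _ (fun j => ?_) ?_
  · simp [Fin.succAbove_ne]
  · exact (S.orderEmbOfFin h).strictMono.comp (Fin.strictMono_succAbove i)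

theorem adjugateWeight_eq_sum_dppWeight_erase (V : Matrix (Fin d) (Fin (m + 1)) ℝ)
    {S : Finset (Fin d)} (h : S.card = m + 1) :
    adjugateWeight V S =
      ∑ a ∈ S, ∑ l, dppWeight (V.submatrix id (Fin.succAbove l)) (S.erase a) := by
  rw [adjugateWeight, dif_pos h, frobeniusNorm_sq, Finset.sum_comm]
  conv_rhs => rw [← S.map_orderEmbOfFin_univ h, Finset.sum_map]
  refine Finset.sum_congr rfl fun i _ => Finset.sum_congr rfl fun l _ => ?_
  have h' : (S.erase (S.orderEmbOfFin h i)).card = m := by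
    rw [Finset.card_erase_of_mem (S.orderEmbOfFin_mem h i), h, Nat.add_sub_cancel]
  rw [S.map_orderEmbOfFin_univ h, adjugate_fin_succ_eq_det_submatrix, mul_pow,
    ← pow_mul, mul_comm _ 2, pow_mul]
  simp [dppWeight, h', orderEmbOfFin_erase, Function.comp_def]

theorem sum_powersetCard_succ_sum_erase {α M : Type*} [DecidableEq α] [AddCommMonoid M]
    (A : Finset α) (m : ℕ) (g : Finset α → M) :
    ∑ S ∈ A.powersetCard (m + 1), ∑ a ∈ S, g (S.erase a) =
      (A.card - m) • ∑ T ∈ A.powersetCard m, g T := by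
  have h : ∀ T ∈ A.powersetCard m, (A.card - m) • g T = ∑ _a ∈ A \ T, g T := by
    intro T hT
    obtain ⟨hTA, hT⟩ := Finset.mem_powersetCard.1 hT
    rw [Finset.sum_const, Finset.card_sdiff_of_subset hTA, hT]
  rw [Finset.smul_sum, Finset.sum_congr rfl h, Finset.sum_sigma', Finset.sum_sigma']
  refine Finset.sum_nbij' (fun p => ⟨p.1.erase p.2, p.2⟩) (fun p => ⟨insert p.2 p.1, p.2⟩)
    ?_ ?_ ?_ ?_ fun _ _ => rfl
  all_goals
    rintro ⟨S, _⟩ hSa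
    simp only [Finset.mem_sigma, Finset.mem_powersetCard, Finset.mem_sdiff] at hSa ⊢
    clear h
    grind [Finset.insert_erase, Finset.erase_insert, Finset.card_erase_of_mem]

theorem sum_powerset_eq_sum_powersetCard {f : Finset (Fin d) → ℝ}
    (hf : ∀ S, S.card ≠ k → f S = 0) (A : Finset (Fin d)) :
    ∑ S ∈ A.powerset, f S = ∑ S ∈ A.powersetCard k, f S := by
  rw [Finset.powersetCard_eq_filter, Finset.sum_filter]
  exact Finset.sum_congr rfl fun S _ => by grind

theorem trace_adjugate_rowGram (V : Matrix (Fin d) (Fin (m + 1)) ℝ) (A : Finset (Fin d)) :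
    (rowGram V A).adjugate.trace =
      ∑ T ∈ A.powersetCard m, ∑ l, dppWeight (V.submatrix id (Fin.succAbove l)) T := by
  rw [Finset.sum_comm]
  refine Finset.sum_congr rfl fun l _ => ?_
  rw [diag_apply, adjugate_fin_succ_eq_det_submatrix, ← rowGram_submatrix, det_rowGram,
    sum_powerset_eq_sum_powersetCard (f := dppWeight _) fun S hS => dif_neg hS]
  simp [← two_mul]

theorem sum_powerset_adjugateWeight (V : Matrix (Fin d) (Fin (m + 1)) ℝ) (A : Finset (Fin d)) :
    ∑ S ∈ A.powerset, adjugateWeight V S =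
      (A.card - m : ℕ) * (rowGram V A).adjugate.trace := by
  rw [trace_adjugate_rowGram, ← nsmul_eq_mul, ← sum_powersetCard_succ_sum_erase,
    sum_powerset_eq_sum_powersetCard (f := adjugateWeight V) fun S hS => dif_neg hS]
  exact Finset.sum_congr rfl fun S hS =>
    adjugateWeight_eq_sum_dppWeight_erase V (Finset.mem_powersetCard.1 hS).2

end Weights

section Eigenvalues

open Matrix

variable {n : Type*}

theorem one_sub_sum_one_sub_le_prod {s : Finset n} {x : n → ℝ} (h0 : ∀ i ∈ s, 0 ≤ x i)
    (h1 : ∀ i ∈ s, x i ≤ 1) : 1 - ∑ i ∈ s, (1 - x i) ≤ ∏ i ∈ s, x i := by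
  induction s using Finset.cons_induction with
  | empty => simp
  | cons a s ha ih =>
    rw [Finset.forall_mem_cons] at h0 h1
    rw [Finset.sum_cons, Finset.prod_cons]
    nlinarith [ih h0.2 h1.2, Finset.prod_le_one h0.2 h1.2]

variable [Fintype n] [DecidableEq n]

theorem prod_erase_le_mul_prod {x : n → ℝ} (h0 : ∀ i, 0 ≤ x i) {θ : ℝ} {i : n}
    (hi : 1 ≤ θ * x i) : ∏ j ∈ Finset.univ.erase i, x j ≤ θ * ∏ j, x j := by
  rw [← Finset.mul_prod_erase _ _ (Finset.mem_univ i), ← mul_assoc]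
  exact le_mul_of_one_le_left (Finset.prod_nonneg fun j _ => h0 j) hi

theorem sum_prod_erase_le {x : n → ℝ} (h0 : ∀ i, 0 ≤ x i) (h1 : ∀ i, x i ≤ 1) {θ : ℝ}
    (hθ : 0 < θ) (hsum : ∑ i, (1 - x i) ≤ 1 - 1 / θ) :
    ∑ i, ∏ j ∈ Finset.univ.erase i, x j ≤ (Fintype.card n - 1 + θ) * ∏ i, x i := by
  have hle (i : n) : ∏ j ∈ Finset.univ.erase i, x j ≤
      ∏ j, x j + (1 - x i) * (θ * ∏ j, x j) := by
    have hi : 1 ≤ θ * x i := by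
      have h := Finset.single_le_sum (fun j _ => sub_nonneg.2 (h1 j)) (Finset.mem_univ i)
      rw [← div_le_iff₀' hθ]
      linarith [h.trans hsum]
    have h := mul_le_mul_of_nonneg_left (prod_erase_le_mul_prod h0 hi) (sub_nonneg.2 (h1 i))
    rw [← Finset.mul_prod_erase _ _ (Finset.mem_univ i)] at h ⊢
    linarith
  calc ∑ i, ∏ j ∈ Finset.univ.erase i, x j
      ≤ ∑ i, (∏ j, x j + (1 - x i) * (θ * ∏ j, x j)) := Finset.sum_le_sum fun i _ => hle i
    _ = Fintype.card n * ∏ j, x j + (∑ i, (1 - x i)) * (θ * ∏ j, x j) := by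
        rw [Finset.sum_add_distrib, ← Finset.sum_mul]
        simp
    _ ≤ Fintype.card n * ∏ j, x j + (1 - 1 / θ) * (θ * ∏ j, x j) := by
        have := Finset.prod_nonneg fun j (_ : j ∈ Finset.univ) => h0 j
        gcongr
    _ = (Fintype.card n - 1 + θ) * ∏ j, x j := by
        field_simp
        ring

variable {G : Matrix n n ℝ}

theorem trace_adjugate_eq_sum_prod_eigenvalues (hG : G.IsHermitian) :
    G.adjugate.trace = ∑ i, ∏ j ∈ Finset.univ.erase i, hG.eigenvalues j := by
  conv_lhs => rw [hG.spectral_theorem, Unitary.conjStarAlgAut_apply]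
  rw [adjugate_mul_distrib, adjugate_mul_distrib, ← Matrix.mul_assoc, trace_mul_comm,
    ← Matrix.mul_assoc, ← adjugate_mul_distrib, Unitary.coe_star_mul_self, adjugate_one,
    Matrix.one_mul, adjugate_diagonal, trace_diagonal]
  rfl

theorem eigenvalues_le_one (hG : G.IsHermitian) (hG1 : (1 - G).PosSemidef) (i : n) :
    hG.eigenvalues i ≤ 1 := by
  have hv : star (hG.eigenvectorBasis i).ofLp ⬝ᵥ (hG.eigenvectorBasis i).ofLp = 1 := by
    rw [dotProduct_comm, ← EuclideanSpace.inner_eq_star_dotProduct, real_inner_self_eq_norm_sq,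
      hG.eigenvectorBasis.orthonormal.1, one_pow]
  have h := hG1.dotProduct_mulVec_nonneg (hG.eigenvectorBasis i).ofLp
  rw [sub_mulVec, one_mulVec, hG.mulVec_eigenvectorBasis, dotProduct_sub, dotProduct_smul, hv,
    smul_eq_mul, mul_one] at h
  exact sub_nonneg.1 h

theorem sum_one_sub_eigenvalues (hG : G.IsHermitian) :
    ∑ i, (1 - hG.eigenvalues i) = Fintype.card n - G.trace := by
  simp [Finset.sum_sub_distrib, hG.trace_eq_sum_eigenvalues]

theorem one_div_le_det (hG : G.PosSemidef) (hG1 : (1 - G).PosSemidef) {θ : ℝ}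
    (htr : (Fintype.card n : ℝ) - 1 + 1 / θ ≤ G.trace) : 1 / θ ≤ G.det := by
  have h := one_sub_sum_one_sub_le_prod (s := Finset.univ) (fun i _ => hG.eigenvalues_nonneg i)
    fun i _ => eigenvalues_le_one hG.isHermitian hG1 i
  have hdet : G.det = ∏ i, hG.isHermitian.eigenvalues i := hG.isHermitian.det_eq_prod_eigenvalues
  rw [sum_one_sub_eigenvalues, ← hdet] at h
  linarith

theorem trace_adjugate_le_mul_det (hG : G.PosSemidef) (hG1 : (1 - G).PosSemidef) {θ : ℝ}
    (hθ : 0 < θ) (htr : (Fintype.card n : ℝ) - 1 + 1 / θ ≤ G.trace) :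
    G.adjugate.trace ≤ (Fintype.card n - 1 + θ) * G.det := by
  have hdet : G.det = ∏ i, hG.isHermitian.eigenvalues i := hG.isHermitian.det_eq_prod_eigenvalues
  rw [trace_adjugate_eq_sum_prod_eigenvalues hG.isHermitian, hdet]
  refine sum_prod_erase_le hG.eigenvalues_nonneg (eigenvalues_le_one hG.isHermitian hG1) hθ ?_
  rw [sum_one_sub_eigenvalues]
  linarith

end Eigenvalues

section ObliqueProjection

open Matrix

variable {N d k : ℕ} {X E : Matrix (Fin N) (Fin d) ℝ} {V C : Matrix (Fin d) (Fin k) ℝ}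

theorem sub_mul_transpose_mul_transpose_self (hV : Vᵀ * V = 1) (hE : E * V = 0) :
    (E - E * C * Vᵀ) * (E - E * C * Vᵀ)ᵀ = E * Eᵀ + E * C * (E * C)ᵀ := by
  have hE' : Vᵀ * Eᵀ = 0 := by rw [← transpose_mul, hE, transpose_zero]
  have hcross : E * C * Vᵀ * Eᵀ = 0 := by rw [Matrix.mul_assoc, hE', Matrix.mul_zero]
  have hcross' : E * (V * (E * C)ᵀ) = 0 := by rw [← Matrix.mul_assoc, hE, Matrix.zero_mul]
  have hsq : E * C * Vᵀ * (V * (E * C)ᵀ) = E * C * (E * C)ᵀ := by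
    rw [Matrix.mul_assoc, ← Matrix.mul_assoc Vᵀ, hV, Matrix.one_mul]
  rw [transpose_sub, transpose_mul (E * C), transpose_transpose, Matrix.sub_mul, Matrix.mul_sub,
    Matrix.mul_sub, hcross, hcross', hsq]
  abel

theorem frobeniusNorm_sub_mul_transpose_sq_le (hV : Vᵀ * V = 1) (hE : E * V = 0) :
    frobeniusNorm (E - E * C * Vᵀ) ^ 2 ≤
      frobeniusNorm E ^ 2 + spectralNorm E ^ 2 * frobeniusNorm C ^ 2 := by
  rw [frobeniusNorm_sq_eq_trace, sub_mul_transpose_mul_transpose_self hV hE, trace_add,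
    ← frobeniusNorm_sq_eq_trace, ← frobeniusNorm_sq_eq_trace, ← mul_pow]
  gcongr
  · exact frobeniusNorm_nonneg _
  · exact frobeniusNorm_mul_le_spectralNorm_mul E C

theorem frobeniusNorm_sub_sq (hV : Vᵀ * V = 1) (hC : Vᵀ * C = 1) :
    frobeniusNorm (C - V) ^ 2 = frobeniusNorm C ^ 2 - k := by
  have hC' : Cᵀ * V = 1 := by rw [← transpose_transpose (Cᵀ * V), transpose_mul,
    transpose_transpose, hC, transpose_one]
  rw [← frobeniusNorm_transpose, ← frobeniusNorm_transpose C, frobeniusNorm_sq_eq_trace,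
    frobeniusNorm_sq_eq_trace, transpose_transpose, transpose_transpose, transpose_sub,
    Matrix.sub_mul, Matrix.mul_sub, Matrix.mul_sub, hV, hC, hC']
  simp

theorem spectralNorm_sub_mul_transpose_sq_le (hV : Vᵀ * V = 1) (hC : Vᵀ * C = 1) (hE : E * V = 0) :
    spectralNorm (E - E * C * Vᵀ) ^ 2 ≤
      spectralNorm E ^ 2 * (1 + (frobeniusNorm C ^ 2 - k)) := by
  have hEC : E * C = E * (C - V) := by rw [Matrix.mul_sub, hE, sub_zero]
  have hle : spectralNorm (E * C) ≤ spectralNorm E * frobeniusNorm (C - V) := by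
    rw [hEC]
    exact (spectralNorm_mul_le _ _).trans
      (mul_le_mul_of_nonneg_left (spectralNorm_le_frobeniusNorm _) (spectralNorm_nonneg _))
  calc spectralNorm (E - E * C * Vᵀ) ^ 2
      = spectralNorm (E * Eᵀ + E * C * (E * C)ᵀ) := by
        rw [← spectralNorm_mul_transpose_self, sub_mul_transpose_mul_transpose_self hV hE]
    _ ≤ spectralNorm E ^ 2 + spectralNorm (E * C) ^ 2 := by
        rw [← spectralNorm_mul_transpose_self E, ← spectralNorm_mul_transpose_self (E * C)]
        exact spectralNorm_add_le _ _
    _ ≤ spectralNorm E ^ 2 + (spectralNorm E * frobeniusNorm (C - V)) ^ 2 := by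
        gcongr
        exact spectralNorm_nonneg _
    _ = spectralNorm E ^ 2 * (1 + (frobeniusNorm C ^ 2 - k)) := by
        rw [mul_pow, frobeniusNorm_sub_sq hV hC]
        ring

variable {S : Finset (Fin d)}

theorem exists_transpose_mul_eq_one_of_dppWeight_ne_zero (hS : dppWeight V S ≠ 0) :
    ∃ C : Matrix (Fin d) (Fin k) ℝ, Vᵀ * C = 1 ∧ (∀ a ∉ S, C a = 0) ∧
      dppWeight V S * frobeniusNorm C ^ 2 = adjugateWeight V S := by
  have hcard : S.card = k := by
    by_contra h
    exact hS (dif_neg h)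
  rw [dppWeight, dif_pos hcard] at hS ⊢
  rw [adjugateWeight, dif_pos hcard]
  set f := S.orderEmbOfFin hcard
  set W := V.submatrix f id
  have hdet : IsUnit W.det := isUnit_iff_ne_zero.2 (pow_ne_zero_iff two_ne_zero |>.1 hS)
  let P : Matrix (Fin d) (Fin k) ℝ := (1 : Matrix (Fin d) (Fin d) ℝ).submatrix id f
  have hVP : Vᵀ * P = Wᵀ := by
    ext i j
    simp [P, W, mul_apply, one_apply]
  have hPP : Pᵀ * P = 1 := by
    ext i j
    simp [P, mul_apply, one_apply, f.injective.eq_iff, eq_comm]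
  have hnorm : frobeniusNorm (P * (W⁻¹)ᵀ) ^ 2 = frobeniusNorm W⁻¹ ^ 2 := by
    rw [← frobeniusNorm_transpose, frobeniusNorm_sq_eq_trace, transpose_transpose, transpose_mul,
      transpose_transpose, Matrix.mul_assoc, ← Matrix.mul_assoc Pᵀ, hPP, Matrix.one_mul,
      frobeniusNorm_sq_eq_trace]
  refine ⟨P * (W⁻¹)ᵀ, ?_, fun a ha => ?_, ?_⟩
  · rw [← Matrix.mul_assoc, hVP, ← transpose_mul, nonsing_inv_mul _ hdet, transpose_one]
  · have hPa : P a = 0 := funext fun j => one_apply_ne fun h : a = f j =>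
      ha (h ▸ S.orderEmbOfFin_mem hcard j)
    ext i
    simp [mul_apply, hPa]
  · have hadj : W.adjugate = W.det • W⁻¹ := by
      rw [inv_def, smul_smul, Ring.mul_inverse_cancel _ hdet, one_smul]
    simp [hnorm, hadj, frobeniusNorm_sq, mul_pow, Finset.mul_sum]

theorem mul_mul_mem_colSpan (hC : ∀ a ∉ S, C a = 0) (B : Matrix (Fin k) (Fin d) ℝ) :
    X * C * B ∈ colSpan X S := by
  refine ⟨(C * B).submatrix Subtype.val id, ?_⟩
  ext i j
  rw [Matrix.mul_assoc, mul_apply (M := X)]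
  refine (Finset.sum_coe_sort S fun a => X i a * (C * B) a j).trans ?_
  refine Finset.sum_subset (Finset.subset_univ S) fun a _ ha => ?_
  simp [mul_apply, hC a ha]

theorem matNorm_nonneg (ν : NormKind) (A : Matrix (Fin N) (Fin d) ℝ) : 0 ≤ matNorm ν A :=
  match ν with
  | .spectral => spectralNorm_nonneg A
  | .frobenius => frobeniusNorm_nonneg A

/-- The residual of projecting the rows of `X` orthogonally onto the span of the columns of `V`,
which are meant to be orthonormal. -/
def residual (X : Matrix (Fin N) (Fin d) ℝ) (V : Matrix (Fin d) (Fin k) ℝ) :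
    Matrix (Fin N) (Fin d) ℝ :=
  X - X * V * Vᵀ

theorem residual_mul_self (X : Matrix (Fin N) (Fin d) ℝ) (hV : Vᵀ * V = 1) :
    residual X V * V = 0 := by
  rw [residual, Matrix.sub_mul, Matrix.mul_assoc (X * V), hV, Matrix.mul_one, sub_self]

theorem matNorm_sub_colProj_sq_le (ν : NormKind) (X : Matrix (Fin N) (Fin d) ℝ)
    (hC : Vᵀ * C = 1) (hCS : ∀ a ∉ S, C a = 0) :
    matNorm ν (X - colProj ν X S) ^ 2 ≤
      matNorm ν (residual X V - residual X V * C * Vᵀ) ^ 2 := by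
  have hres : residual X V - residual X V * C * Vᵀ = X - X * C * Vᵀ := by
    simp only [residual, Matrix.sub_mul, Matrix.mul_assoc _ Vᵀ C, hC, Matrix.mul_one]
    abel
  rw [hres]
  exact pow_le_pow_left₀ (matNorm_nonneg _ _)
    ((exists_colProj ν X S).choose_spec.2 _ (mul_mul_mem_colSpan hCS Vᵀ)) 2

theorem adjugateWeight_nonneg (V : Matrix (Fin d) (Fin k) ℝ) (S : Finset (Fin d)) :
    0 ≤ adjugateWeight V S := by
  unfold adjugateWeight
  split_ifs <;> positivity

theorem dppWeight_mul_spectral_sq_le (X : Matrix (Fin N) (Fin d) ℝ) (hk : 1 ≤ k) (hV : Vᵀ * V = 1)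
    (S : Finset (Fin d)) :
    dppWeight V S * matNorm .spectral (X - colProj .spectral X S) ^ 2 ≤
      spectralNorm (residual X V) ^ 2 * adjugateWeight V S := by
  by_cases hS : dppWeight V S = 0
  · rw [hS, zero_mul]
    exact mul_nonneg (sq_nonneg _) (adjugateWeight_nonneg V S)
  obtain ⟨C, hC, hCS, hadj⟩ := exists_transpose_mul_eq_one_of_dppWeight_ne_zero hS
  have hk' : (1 : ℝ) ≤ k := Nat.one_le_cast.2 hk
  rw [← hadj, mul_left_comm]
  refine mul_le_mul_of_nonneg_left ?_ (dppWeight_nonneg V S)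
  calc matNorm .spectral (X - colProj .spectral X S) ^ 2
      ≤ spectralNorm (residual X V) ^ 2 * (1 + (frobeniusNorm C ^ 2 - k)) :=
        (matNorm_sub_colProj_sq_le .spectral X hC hCS).trans
          (spectralNorm_sub_mul_transpose_sq_le hV hC (residual_mul_self X hV))
    _ ≤ spectralNorm (residual X V) ^ 2 * frobeniusNorm C ^ 2 := by
        gcongr
        linarith

theorem dppWeight_mul_frobenius_sq_le (X : Matrix (Fin N) (Fin d) ℝ) (hV : Vᵀ * V = 1)
    (S : Finset (Fin d)) :
    dppWeight V S * matNorm .frobenius (X - colProj .frobenius X S) ^ 2 ≤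
      frobeniusNorm (residual X V) ^ 2 * dppWeight V S +
        spectralNorm (residual X V) ^ 2 * adjugateWeight V S := by
  by_cases hS : dppWeight V S = 0
  · rw [hS, zero_mul, mul_zero, zero_add]
    exact mul_nonneg (sq_nonneg _) (adjugateWeight_nonneg V S)
  obtain ⟨C, hC, hCS, hadj⟩ := exists_transpose_mul_eq_one_of_dppWeight_ne_zero hS
  rw [← hadj, mul_left_comm, mul_comm (frobeniusNorm (residual X V) ^ 2), ← mul_add]
  exact mul_le_mul_of_nonneg_left ((matNorm_sub_colProj_sq_le .frobenius X hC hCS).trans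
    (frobeniusNorm_sub_mul_transpose_sq_le hV (residual_mul_self X hV))) (dppWeight_nonneg V S)

end ObliqueProjection

section EckartYoung

open Matrix

theorem exists_isStarProjection_mul_eq_zero {n : Type*} [Fintype n]
    (B : Matrix n n ℝ) :
    ∃ P : Matrix n n ℝ, IsStarProjection P ∧ B * P = 0 ∧ P.trace = Fintype.card n - B.rank := by
  classical
  have hG := isHermitian_conjTranspose_mul_self B
  let φ := Unitary.conjStarAlgAut ℝ (Matrix n n ℝ) hG.eigenvectorUnitary
  let D : Matrix n n ℝ := diagonal fun i => if hG.eigenvalues i = 0 then 1 else 0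
  have hD : IsStarProjection D := by
    refine ⟨?_, ?_⟩
    · simp [IsIdempotentElem, D]
    · simp [IsSelfAdjoint, star_eq_conjTranspose, D]
  -- `φ D` is the spectral projection onto the kernel of `Bᴴ * B`, which is also that of `B`.
  refine ⟨φ D, hD.map φ, ?_, ?_⟩
  · have hmul : Bᴴ * B * φ D = 0 := by
      conv_lhs => enter [1]; rw [hG.spectral_theorem]
      rw [← map_mul, diagonal_mul_diagonal]
      convert map_zero φ
      ext i j
      simp [diagonal_apply]
    rwa [conjTranspose_mul_self_mul_eq_zero] at hmul
  · have hrank := hG.rank_eq_card_non_zero_eigs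
    rw [rank_conjTranspose_mul_self] at hrank
    have htr : (φ D).trace = D.trace := by
      rw [Unitary.conjStarAlgAut_apply, trace_mul_comm, ← Matrix.mul_assoc,
        Unitary.coe_star_mul_self, Matrix.one_mul]
    have htrD : D.trace = Fintype.card {i // hG.eigenvalues i = 0} := by
      simp [D, trace_diagonal, Fintype.card_subtype]
    rw [htr, htrD, hrank, eq_sub_iff_add_eq, ← Nat.cast_add, Fintype.card_subtype_compl]
    exact congrArg _ (Nat.add_sub_cancel' (Fintype.card_subtype_le _))

theorem sum_filter_le_sum_mul {r k : ℕ} {f w : Fin r → ℝ} (hf : Antitone f) (hf0 : ∀ j, 0 ≤ f j)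
    (hw0 : ∀ j, 0 ≤ w j) (hw1 : ∀ j, w j ≤ 1) (hw : (r : ℝ) - k ≤ ∑ j, w j) :
    ∑ j : Fin r with k ≤ j.val, f j ≤ ∑ j, f j * w j := by
  rcases le_or_gt r k with hrk | hkr
  · rw [Finset.filter_false_of_mem fun j _ => by omega, Finset.sum_empty]
    exact Finset.sum_nonneg fun j _ => mul_nonneg (hf0 j) (hw0 j)
  have hcard : ∑ j : Fin r, (if k ≤ j.val then (1 : ℝ) else 0) = r - k := by
    rw [Finset.sum_boole, ← Nat.cast_sub hkr.le]
    have hIci : (Finset.univ.filter fun j : Fin r => k ≤ j.val) = Finset.Ici ⟨k, hkr⟩ := by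
      ext j
      simp [Fin.le_def]
    rw [hIci, Fin.card_Ici]
  -- The difference of the weights is nonnegative where `f ≥ f k` and nonpositive where `f ≤ f k`.
  have hle (j : Fin r) : f j * (if k ≤ j.val then 1 else 0) +
      f ⟨k, hkr⟩ * (w j - if k ≤ j.val then 1 else 0) ≤ f j * w j := by
    split_ifs with hj
    · nlinarith [hw1 j, hf (show (⟨k, hkr⟩ : Fin r) ≤ j from hj)]
    · nlinarith [hw0 j, hf (show j ≤ (⟨k, hkr⟩ : Fin r) from (not_le.1 hj).le)]
  have hsum := Finset.sum_le_sum fun j (_ : j ∈ Finset.univ) => hle j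
  rw [Finset.sum_add_distrib, ← Finset.mul_sum, Finset.sum_sub_distrib, hcard] at hsum
  simp only [mul_ite, mul_one, mul_zero, ← Finset.sum_filter] at hsum
  nlinarith [mul_nonneg (hf0 ⟨k, hkr⟩) (sub_nonneg.2 hw)]

theorem spectralNorm_le_one_of_isStarProjection {n : ℕ} {P : Matrix (Fin n) (Fin n) ℝ}
    (hP : IsStarProjection P) : spectralNorm P ≤ 1 := by
  open scoped Matrix.Norms.L2Operator in
  exact hP.norm_le

variable {N d r k : ℕ}

theorem sum_filter_sq_le_frobeniusNorm_diagonal_sub_sq {σ : Fin r → ℝ} (hσ : Antitone σ)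
    (hσ0 : ∀ i, 0 ≤ σ i) {B : Matrix (Fin r) (Fin r) ℝ} (hB : B.rank ≤ k) :
    ∑ j : Fin r with k ≤ j.val, σ j ^ 2 ≤ frobeniusNorm (diagonal σ - B) ^ 2 := by
  obtain ⟨P, hP, hBP, htr⟩ := exists_isStarProjection_mul_eq_zero B
  have hPt : P * Pᵀ = P := by
    rw [← conjTranspose_eq_transpose_of_trivial, ← star_eq_conjTranspose,
      hP.isSelfAdjoint.star_eq, hP.isIdempotentElem.eq]
  have hdiag (j : Fin r) : P j j = ∑ i, P j i ^ 2 := by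
    conv_lhs => rw [← hPt]
    simp [mul_apply, sq]
  have hDP : frobeniusNorm (diagonal σ * P) ^ 2 = ∑ j, σ j ^ 2 * P j j := by
    simp [frobeniusNorm_sq, mul_pow, hdiag, Finset.mul_sum]
  have hle : frobeniusNorm (diagonal σ * P) ≤ frobeniusNorm (diagonal σ - B) := by
    have h := frobeniusNorm_mul_le_mul_spectralNorm (diagonal σ - B) P
    rw [Matrix.sub_mul, hBP, sub_zero] at h
    exact h.trans (mul_le_of_le_one_right (frobeniusNorm_nonneg _)
      (spectralNorm_le_one_of_isStarProjection hP))
  refine le_trans ?_ (hDP ▸ pow_le_pow_left₀ (frobeniusNorm_nonneg _) hle 2)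
  have hP0 (j : Fin r) : 0 ≤ P j j := hdiag j ▸ Finset.sum_nonneg fun i _ => sq_nonneg _
  refine sum_filter_le_sum_mul (fun i j hij => pow_le_pow_left₀ (hσ0 j) (hσ hij) 2)
    (fun j => sq_nonneg _) hP0 (fun j => ?_) ?_
  · have hsq : P j j ^ 2 ≤ P j j := (Finset.single_le_sum (f := fun i => P j i ^ 2)
      (fun i _ => sq_nonneg _) (Finset.mem_univ j)).trans_eq (hdiag j).symm
    nlinarith [hP0 j]
  · rw [trace, Fintype.card_fin] at htr
    simp only [diag_apply] at htr
    rw [htr]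
    gcongr

theorem le_spectralNorm_diagonal_sub {n : ℕ} {v : Fin n → ℝ} {s : ℝ} (hs : 0 ≤ s)
    (hv : ∀ i, s ≤ v i) {B : Matrix (Fin n) (Fin n) ℝ} (hB : B.det = 0) :
    s ≤ spectralNorm (diagonal v - B) := by
  obtain ⟨c, hc, hBc⟩ := exists_mulVec_eq_zero_iff.2 hB
  have hpos : 0 < ∑ i, c i ^ 2 := by
    obtain ⟨i, hi⟩ := Function.ne_iff.1 hc
    exact Finset.sum_pos' (fun _ _ => sq_nonneg _) ⟨i, Finset.mem_univ i, sq_pos_of_ne_zero hi⟩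
  have h := sum_mulVec_sq_le (diagonal v - B) c
  simp only [sub_mulVec, hBc, sub_zero, mulVec_diagonal, mul_pow] at h
  refine le_of_sq_le_sq (le_of_mul_le_mul_right (le_trans ?_ h) hpos) (spectralNorm_nonneg _)
  rw [Finset.mul_sum]
  gcongr with i
  exact hv i

theorem matNorm_mul_mul_le {m n : ℕ} (ν : NormKind) {A : Matrix (Fin m) (Fin N) ℝ}
    {B : Matrix (Fin d) (Fin n) ℝ} (hA : spectralNorm A ≤ 1) (hB : spectralNorm B ≤ 1)
    (M : Matrix (Fin N) (Fin d) ℝ) : matNorm ν (A * M * B) ≤ matNorm ν M := by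
  cases ν with
  | spectral =>
    calc spectralNorm (A * M * B)
        ≤ spectralNorm (A * M) := (spectralNorm_mul_le _ _).trans
          (mul_le_of_le_one_right (spectralNorm_nonneg _) hB)
      _ ≤ spectralNorm M := (spectralNorm_mul_le _ _).trans
          (mul_le_of_le_one_left (spectralNorm_nonneg _) hA)
  | frobenius =>
    calc frobeniusNorm (A * M * B)
        ≤ frobeniusNorm (A * M) := (frobeniusNorm_mul_le_mul_spectralNorm _ _).trans
          (mul_le_of_le_one_right (frobeniusNorm_nonneg _) hB)
      _ ≤ frobeniusNorm M := (frobeniusNorm_mul_le_spectralNorm_mul _ _).trans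
          (mul_le_of_le_one_left (frobeniusNorm_nonneg _) hA)

/-- The singular value `σ_{k+1}`, which is `0` for `k ≥ r`. -/
noncomputable def nextSingular (k : ℕ) (σ : Fin r → ℝ) : ℝ :=
  if h : k < r then σ ⟨k, h⟩ else 0

variable {X A : Matrix (Fin N) (Fin d) ℝ} {U : Matrix (Fin N) (Fin r) ℝ} {σ : Fin r → ℝ}
  {V : Matrix (Fin d) (Fin r) ℝ}

theorem nextSingular_nonneg (hσ : ∀ i, 0 ≤ σ i) : 0 ≤ nextSingular k σ := by
  unfold nextSingular
  split_ifs
  exacts [hσ _, le_rfl]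

theorem firstCols_mul_transpose (hk : k ≤ r) (V : Matrix (Fin d) (Fin r) ℝ) :
    firstCols hk V * (firstCols hk V)ᵀ =
      V * diagonal (fun j : Fin r => if k ≤ j.val then (0 : ℝ) else 1) * Vᵀ := by
  ext a b
  rw [mul_apply, mul_apply]
  simp only [mul_diagonal, transpose_apply, firstCols, submatrix_apply, id]
  refine Fintype.sum_of_injective (Fin.castLE hk) (Fin.castLE_injective hk) _ _ (fun j hj => ?_)
    fun j => by simp
  rw [Fin.range_castLE, Set.mem_ofPred_eq, not_lt] at hj
  simp [hj]

theorem IsThinSVD.residual_eq (hX : IsThinSVD X U σ V) (hk : k ≤ r) :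
    residual X (firstCols hk V) =
      U * diagonal (fun j => if k ≤ j.val then σ j else 0) * Vᵀ := by
  have hσ : diagonal (fun j => if k ≤ j.val then σ j else 0) =
      diagonal σ - diagonal σ * diagonal (fun j => if k ≤ j.val then (0 : ℝ) else 1) := by
    rw [diagonal_mul_diagonal, diagonal_sub]
    congr 1
    ext j
    split_ifs <;> simp
  have hUV (D : Matrix (Fin r) (Fin r) ℝ) :
      U * diagonal σ * Vᵀ * (V * D * Vᵀ) = U * (diagonal σ * D) * Vᵀ := by
    rw [← Matrix.mul_assoc, ← Matrix.mul_assoc, Matrix.mul_assoc _ Vᵀ V, hX.orthV, Matrix.mul_one,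
      Matrix.mul_assoc U]
  rw [residual, Matrix.mul_assoc, firstCols_mul_transpose, hX.eq, hUV, hσ, Matrix.mul_sub,
    Matrix.sub_mul]

theorem IsThinSVD.spectralNorm_residual_le (hX : IsThinSVD X U σ V) (hk : k ≤ r) :
    spectralNorm (residual X (firstCols hk V)) ≤ nextSingular k σ := by
  have h0 : 0 ≤ nextSingular k σ := nextSingular_nonneg fun i => (hX.pos i).le
  rw [hX.residual_eq hk]
  refine (matNorm_mul_mul_le .spectral (spectralNorm_le_one_of_transpose_mul_self_eq_one hX.orthU)
    ((spectralNorm_transpose V).trans_le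
      (spectralNorm_le_one_of_transpose_mul_self_eq_one hX.orthV)) _).trans
    (spectralNorm_diagonal_le h0 fun i => ?_)
  split_ifs with h
  · rw [abs_of_pos (hX.pos i), nextSingular, dif_pos (h.trans_lt i.2)]
    exact hX.anti h
  · rwa [abs_zero]

theorem IsThinSVD.frobeniusNorm_residual_sq_le (hX : IsThinSVD X U σ V) (hk : k ≤ r) :
    frobeniusNorm (residual X (firstCols hk V)) ^ 2 ≤ ∑ j : Fin r with k ≤ j.val, σ j ^ 2 := by
  have hD : frobeniusNorm (diagonal fun j => if k ≤ j.val then σ j else 0) ^ 2 =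
      ∑ j : Fin r with k ≤ j.val, σ j ^ 2 := by
    simp [frobeniusNorm_sq, diagonal_apply, Finset.sum_filter, ite_pow]
  rw [hX.residual_eq hk, ← hD]
  refine pow_le_pow_left₀ (frobeniusNorm_nonneg _) ?_ 2
  exact matNorm_mul_mul_le .frobenius (spectralNorm_le_one_of_transpose_mul_self_eq_one hX.orthU)
    ((spectralNorm_transpose V).trans_le
      (spectralNorm_le_one_of_transpose_mul_self_eq_one hX.orthV)) _

theorem IsThinSVD.transpose_firstCols_mul_mul (hX : IsThinSVD X U σ V) (hk : k ≤ r) :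
    (firstCols hk U)ᵀ * X * firstCols hk V = diagonal (σ ∘ Fin.castLE hk) := by
  have h : Uᵀ * X * V = diagonal σ := by
    rw [hX.eq, Matrix.mul_assoc, Matrix.mul_assoc _ Vᵀ, hX.orthV, Matrix.mul_one,
      ← Matrix.mul_assoc, hX.orthU, Matrix.one_mul]
  rw [← submatrix_diagonal _ _ (Fin.castLE_injective hk), ← h]
  rfl

theorem IsThinSVD.matNorm_diagonal_sub_le (hX : IsThinSVD X U σ V) (ν : NormKind) (hk : k ≤ r)
    (A : Matrix (Fin N) (Fin d) ℝ) :
    matNorm ν (diagonal (σ ∘ Fin.castLE hk) - (firstCols hk U)ᵀ * A * firstCols hk V) ≤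
      matNorm ν (X - A) := by
  rw [← hX.transpose_firstCols_mul_mul hk, ← Matrix.sub_mul, ← Matrix.mul_sub]
  exact matNorm_mul_mul_le ν ((spectralNorm_transpose _).trans_le
      (spectralNorm_le_one_of_transpose_mul_self_eq_one (firstCols_orth hk hX.orthU)))
    (spectralNorm_le_one_of_transpose_mul_self_eq_one (firstCols_orth hk hX.orthV)) _

theorem rank_mul_mul_le {m n : ℕ} (B : Matrix (Fin m) (Fin N) ℝ) (A : Matrix (Fin N) (Fin d) ℝ)
    (C : Matrix (Fin d) (Fin n) ℝ) : (B * A * C).rank ≤ A.rank :=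
  (rank_mul_le_left _ _).trans (rank_mul_le_right _ _)

theorem IsThinSVD.nextSingular_le (hX : IsThinSVD X U σ V) (hA : A.rank ≤ k) :
    nextSingular k σ ≤ spectralNorm (X - A) := by
  unfold nextSingular
  split_ifs with hk
  · refine le_trans ?_ (hX.matNorm_diagonal_sub_le .spectral hk A)
    refine le_spectralNorm_diagonal_sub (hX.pos _).le
      (fun i => hX.anti (Nat.lt_succ_iff.1 i.2)) ?_
    by_contra hdet
    have hrank := rank_of_isUnit _ ((isUnit_iff_isUnit_det _).2 (isUnit_iff_ne_zero.2 hdet))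
    have := rank_mul_mul_le (firstCols hk U)ᵀ A (firstCols hk V)
    rw [Fintype.card_fin] at hrank
    omega
  · exact spectralNorm_nonneg _

theorem IsThinSVD.sum_filter_sq_le (hX : IsThinSVD X U σ V) (hA : A.rank ≤ k) :
    ∑ j : Fin r with k ≤ j.val, σ j ^ 2 ≤ frobeniusNorm (X - A) ^ 2 := by
  refine (sum_filter_sq_le_frobeniusNorm_diagonal_sub_sq hX.anti (fun i => (hX.pos i).le)
    ((rank_mul_mul_le (firstCols le_rfl U)ᵀ A (firstCols le_rfl V)).trans hA)).trans ?_
  exact pow_le_pow_left₀ (frobeniusNorm_nonneg _)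
    (hX.matNorm_diagonal_sub_le .frobenius le_rfl A) 2

theorem IsThinSVD.le_cols (hX : IsThinSVD X U σ V) : r ≤ d := by
  have h := rank_mul_le_right Vᵀ V
  rw [hX.orthV, rank_one, Fintype.card_fin] at h
  simpa using h.trans (rank_le_card_height V)

theorem flatness_nonneg (hkd : k ≤ d) (σ : Fin r → ℝ) : 0 ≤ flatness d k σ := by
  have : (0 : ℝ) ≤ d - k := sub_nonneg.2 (Nat.cast_le.2 hkd)
  unfold flatness
  split_ifs <;> positivity

theorem IsThinSVD.flatness_div_mul_sum (hX : IsThinSVD X U σ V) :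
    flatness d k σ / (d - k) * ∑ j : Fin r with k ≤ j.val, σ j ^ 2 = nextSingular k σ ^ 2 := by
  unfold flatness nextSingular
  split_ifs with hk
  · have hsum : 0 < ∑ j : Fin r with k ≤ j.val, σ j ^ 2 :=
      Finset.sum_pos (fun j _ => pow_pos (hX.pos j) 2) ⟨⟨k, hk⟩, by simp⟩
    have hdk : (0 : ℝ) < d - k := sub_pos.2 (Nat.cast_lt.2 (hk.trans_le hX.le_cols))
    field_simp
  · simp

end EckartYoung

section ProjectionProcess

variable {d k : ℕ}

theorem integral_dpp (V : Matrix (Fin d) (Fin k) ℝ) (φ : Finset (Fin d) → ℝ) :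
    ∫ S, φ S ∂dpp V = ∑ S, dppWeight V S * φ S := by
  rw [dpp, integral_finsetSum_measure fun S _ =>
    (integrable_dirac (by simp)).smul_measure ENNReal.ofReal_ne_top]
  refine Finset.sum_congr rfl fun S _ => ?_
  rw [integral_smul_measure, integral_dirac, ENNReal.toReal_ofReal (dppWeight_nonneg V S),
    smul_eq_mul]

theorem setIntegral_dpp_subset (V : Matrix (Fin d) (Fin k) ℝ) (A : Finset (Fin d))
    (φ : Finset (Fin d) → ℝ) :
    ∫ S in {S | S ⊆ A}, φ S ∂dpp V = ∑ S ∈ A.powerset, dppWeight V S * φ S := by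
  rw [← integral_indicator MeasurableSet.of_discrete, integral_dpp, ← Finset.filter_subset_univ,
    Finset.sum_filter]
  refine Finset.sum_congr rfl fun S _ => ?_
  by_cases h : S ⊆ A <;> simp [h]

theorem dpp_real_subset (V : Matrix (Fin d) (Fin k) ℝ) (A : Finset (Fin d)) :
    (dpp V).real {S | S ⊆ A} = (rowGram V A).det := by
  rw [det_rowGram, ← setIntegral_one_eq_measureReal, setIntegral_dpp_subset]
  simp only [mul_one]

theorem integral_cond_dpp_subset (V : Matrix (Fin d) (Fin k) ℝ) (A : Finset (Fin d))
    (φ : Finset (Fin d) → ℝ) :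
    ∫ S, φ S ∂ProbabilityTheory.cond (dpp V) {S | S ⊆ A} =
      (∑ S ∈ A.powerset, dppWeight V S * φ S) / (rowGram V A).det := by
  rw [ProbabilityTheory.cond, integral_smul_measure, ENNReal.toReal_inv, smul_eq_mul,
    setIntegral_dpp_subset, ← measureReal_def, dpp_real_subset, inv_mul_eq_div]

variable {V : Matrix (Fin d) (Fin k) ℝ} {A : Finset (Fin d)} {θ : ℝ}

theorem one_div_le_det_rowGram (hV : Vᵀ * V = 1)
    (hA : (k : ℝ) - 1 + 1 / θ ≤ ∑ j ∈ A, leverage V j) : 1 / θ ≤ (rowGram V A).det :=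
  one_div_le_det (posSemidef_rowGram V A) (posSemidef_one_sub_rowGram hV A)
    (by rwa [Fintype.card_fin, trace_rowGram])

theorem le_card_of_le_sum_leverage (hV : Vᵀ * V = 1) (hθ : 0 < θ)
    (hA : (k : ℝ) - 1 + 1 / θ ≤ ∑ j ∈ A, leverage V j) : k ≤ A.card := by
  have hdet := (one_div_pos.2 hθ).trans_le (one_div_le_det_rowGram hV hA)
  contrapose! hdet
  rw [det_rowGram]
  exact (Finset.sum_eq_zero fun S hS => dif_neg
    ((Finset.card_le_card (Finset.mem_powerset.1 hS)).trans_lt hdet).ne).le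

theorem sum_powerset_adjugateWeight_le (hk : 1 ≤ k) (hV : Vᵀ * V = 1) (hθ : 0 < θ)
    (hA : (k : ℝ) - 1 + 1 / θ ≤ ∑ j ∈ A, leverage V j) :
    ∑ S ∈ A.powerset, adjugateWeight V S ≤
      ((A.card : ℝ) + 1 - k) * (k - 1 + θ) * (rowGram V A).det := by
  have hcard := le_card_of_le_sum_leverage hV hθ hA
  have htr := trace_adjugate_le_mul_det (posSemidef_rowGram V A) (posSemidef_one_sub_rowGram hV A)
    hθ (by rwa [Fintype.card_fin, trace_rowGram])
  rw [Fintype.card_fin] at htr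
  obtain ⟨m, rfl⟩ := Nat.exists_eq_add_of_le' hk
  have hm : ((A.card - m : ℕ) : ℝ) = A.card + 1 - (m + 1 : ℕ) := by
    rw [Nat.cast_sub (m.le_succ.trans hcard), Nat.cast_succ]
    ring
  rw [sum_powerset_adjugateWeight, ← hm, mul_assoc]
  gcongr

theorem integral_cond_dpp_subset_le (hk : 1 ≤ k) (hV : Vᵀ * V = 1) (hθ : 0 < θ)
    (hA : (k : ℝ) - 1 + 1 / θ ≤ ∑ j ∈ A, leverage V j) {φ : Finset (Fin d) → ℝ} {a b : ℝ}
    (hb : 0 ≤ b)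
    (hφ : ∀ S, dppWeight V S * φ S ≤ a * dppWeight V S + b * adjugateWeight V S) :
    ∫ S, φ S ∂ProbabilityTheory.cond (dpp V) {S | S ⊆ A} ≤
      a + b * (((A.card : ℝ) + 1 - k) * (k - 1 + θ)) := by
  have hdet := (one_div_pos.2 hθ).trans_le (one_div_le_det_rowGram hV hA)
  rw [integral_cond_dpp_subset, div_le_iff₀ hdet]
  calc ∑ S ∈ A.powerset, dppWeight V S * φ S
      ≤ a * ∑ S ∈ A.powerset, dppWeight V S + b * ∑ S ∈ A.powerset, adjugateWeight V S := by
        rw [Finset.mul_sum, Finset.mul_sum, ← Finset.sum_add_distrib]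
        exact Finset.sum_le_sum fun S _ => hφ S
    _ ≤ a * (rowGram V A).det +
          b * (((A.card : ℝ) + 1 - k) * (k - 1 + θ) * (rowGram V A).det) := by
        rw [det_rowGram]
        have := sum_powerset_adjugateWeight_le hk hV hθ hA
        rw [det_rowGram] at this
        gcongr
    _ = (a + b * (((A.card : ℝ) + 1 - k) * (k - 1 + θ))) * (rowGram V A).det := by ring

end ProjectionProcess

section ConditionalError

variable {N d r k : ℕ} {X : Matrix (Fin N) (Fin d) ℝ} {U : Matrix (Fin N) (Fin r) ℝ}
  {σ : Fin r → ℝ} {V : Matrix (Fin d) (Fin r) ℝ} {A : Finset (Fin d)} {θ : ℝ}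

theorem card_add_one_sub_mul_nonneg {W : Matrix (Fin d) (Fin k) ℝ} (hk : 1 ≤ k) (hW : Wᵀ * W = 1)
    (hθ : 0 < θ) (hA : (k : ℝ) - 1 + 1 / θ ≤ ∑ j ∈ A, leverage W j) :
    0 ≤ ((A.card : ℝ) + 1 - k) * (k - 1 + θ) := by
  have hcard : (k : ℝ) ≤ A.card := Nat.cast_le.2 (le_card_of_le_sum_leverage hW hθ hA)
  have hk' : (1 : ℝ) ≤ k := Nat.one_le_cast.2 hk
  exact mul_nonneg (by linarith) (by linarith)

theorem IsThinSVD.integral_cond_spectral_sq_le (hX : IsThinSVD X U σ V) (hk : 1 ≤ k) (hkr : k ≤ r)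
    (hθ : 0 < θ) (hA : (k : ℝ) - 1 + 1 / θ ≤ ∑ j ∈ A, leverage (firstCols hkr V) j) :
    ∫ S, matNorm .spectral (X - colProj .spectral X S) ^ 2
        ∂ProbabilityTheory.cond (dpp (firstCols hkr V)) {S | S ⊆ A} ≤
      ((A.card : ℝ) + 1 - k) * (k - 1 + θ) *
        matNorm .spectral (X - bestRank .spectral k X) ^ 2 := by
  have hV := firstCols_orth hkr hX.orthV
  have hbest : spectralNorm (residual X (firstCols hkr V)) ≤
      matNorm .spectral (X - bestRank .spectral k X) :=
    (hX.spectralNorm_residual_le hkr).trans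
      (hX.nextSingular_le (exists_bestRank .spectral k X).choose_spec.1)
  calc _ ≤ 0 + spectralNorm (residual X (firstCols hkr V)) ^ 2 *
        (((A.card : ℝ) + 1 - k) * (k - 1 + θ)) :=
        integral_cond_dpp_subset_le hk hV hθ hA (sq_nonneg _) fun S => by
          rw [zero_mul, zero_add]
          exact dppWeight_mul_spectral_sq_le X hk hV S
    _ ≤ _ := by
        rw [zero_add, mul_comm]
        exact mul_le_mul_of_nonneg_left (pow_le_pow_left₀ (spectralNorm_nonneg _) hbest 2)
          (card_add_one_sub_mul_nonneg hk hV hθ hA)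

theorem IsThinSVD.integral_cond_frobenius_sq_le (hX : IsThinSVD X U σ V) (hk : 1 ≤ k)
    (hkr : k ≤ r) (hθ : 0 < θ)
    (hA : (k : ℝ) - 1 + 1 / θ ≤ ∑ j ∈ A, leverage (firstCols hkr V) j) :
    ∫ S, matNorm .frobenius (X - colProj .frobenius X S) ^ 2
        ∂ProbabilityTheory.cond (dpp (firstCols hkr V)) {S | S ⊆ A} ≤
      (1 + flatness d k σ * (((A.card : ℝ) + 1 - k) / (d - k)) * (k - 1 + θ)) *
        matNorm .frobenius (X - bestRank .frobenius k X) ^ 2 := by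
  have hV := firstCols_orth hkr hX.orthV
  have hkd := hkr.trans hX.le_cols
  have hq := card_add_one_sub_mul_nonneg hk hV hθ hA
  have hc : 0 ≤ flatness d k σ / (d - k) :=
    div_nonneg (flatness_nonneg hkd σ) (sub_nonneg.2 (Nat.cast_le.2 hkd))
  calc _ ≤ frobeniusNorm (residual X (firstCols hkr V)) ^ 2 +
        spectralNorm (residual X (firstCols hkr V)) ^ 2 *
          (((A.card : ℝ) + 1 - k) * (k - 1 + θ)) :=
        integral_cond_dpp_subset_le hk hV hθ hA (sq_nonneg _)
          (dppWeight_mul_frobenius_sq_le X hV)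
    _ ≤ ∑ j : Fin r with k ≤ j.val, σ j ^ 2 +
          nextSingular k σ ^ 2 * (((A.card : ℝ) + 1 - k) * (k - 1 + θ)) := by
        gcongr
        · exact hX.frobeniusNorm_residual_sq_le hkr
        · exact spectralNorm_nonneg _
        · exact hX.spectralNorm_residual_le hkr
    _ = (1 + flatness d k σ / (d - k) * (((A.card : ℝ) + 1 - k) * (k - 1 + θ))) *
          ∑ j : Fin r with k ≤ j.val, σ j ^ 2 := by
        rw [← hX.flatness_div_mul_sum]
        ring
    _ ≤ (1 + flatness d k σ / (d - k) * (((A.card : ℝ) + 1 - k) * (k - 1 + θ))) *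
          matNorm .frobenius (X - bestRank .frobenius k X) ^ 2 := by
        gcongr
        exact hX.sum_filter_sq_le (exists_bestRank .frobenius k X).choose_spec.1
    _ = _ := by ring

end ConditionalError

section EffectiveSparsity

variable {d k : ℕ}

theorem compl_tailSet (π : Equiv.Perm (Fin d)) (q : ℕ) :
    (tailSet π q)ᶜ = (Finset.univ.filter fun i : Fin d => i.val < q).map π.toEmbedding := by
  ext j
  simp [tailSet, ← π.eq_symm_apply]

theorem card_compl_tailSet (π : Equiv.Perm (Fin d)) {q : ℕ} (hq : q ≤ d) :
    (tailSet π q)ᶜ.card = q := by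
  rw [compl_tailSet, Finset.card_map, Fin.card_filter_val_lt, min_eq_right hq]

theorem avoidEvent_eq (V : Matrix (Fin d) (Fin k) ℝ) (π : Equiv.Perm (Fin d)) (θ : ℝ) :
    avoidEvent V π θ = {S | S ⊆ (tailSet π (pEff V π θ))ᶜ} := by
  ext S
  rw [avoidEvent, Set.mem_ofPred_eq, Set.mem_ofPred_eq, ← Finset.disjoint_iff_inter_eq_empty,
    Finset.subset_compl_iff_disjoint_right]

theorem sum_leverage {V : Matrix (Fin d) (Fin k) ℝ} (hV : Vᵀ * V = 1) :
    ∑ j, leverage V j = k := by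
  have h := trace_rowGram V Finset.univ
  rw [rowGram_univ, hV, Matrix.trace_one, Fintype.card_fin] at h
  exact h.symm

theorem pEff_spec {V : Matrix (Fin d) (Fin k) ℝ} (hV : Vᵀ * V = 1) (hd : 1 ≤ d)
    (π : Equiv.Perm (Fin d)) {θ : ℝ} (hθ : 1 ≤ θ) :
    pEff V π θ ≤ d ∧
      (k : ℝ) - 1 + 1 / θ ≤ ∑ j ∈ (tailSet π (pEff V π θ))ᶜ, leverage V j := by
  rw [compl_tailSet, Finset.sum_map]
  refine (Nat.sInf_mem (s := {q | 1 ≤ q ∧ q ≤ d ∧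
    (k : ℝ) - 1 + 1 / θ ≤ ∑ i : Fin d with i.val < q, leverage V (π i)}) ⟨d, hd, le_rfl, ?_⟩).2
  rw [Finset.filter_true_of_mem fun i _ => i.2, Equiv.sum_comp π, sum_leverage hV]
  linarith [(div_le_one (zero_lt_one.trans_le hθ)).2 hθ]

end EffectiveSparsity

end ColumnSubset

theorem mainTheorem3_general {N d r k : ℕ} {X : Matrix (Fin N) (Fin d) ℝ}
    {U : Matrix (Fin N) (Fin r) ℝ} {σ : Fin r → ℝ} {V : Matrix (Fin d) (Fin r) ℝ}
    (hX : IsThinSVD X U σ V) (hk : 1 ≤ k) (hkr : k ≤ r) {A : Finset (Fin d)} {θ : ℝ}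
    (hθ : 0 < θ) (hA : (k : ℝ) - 1 + 1 / θ ≤ ∑ j ∈ A, leverage (firstCols hkr V) j) :
    1 / θ ≤ (dpp (firstCols hkr V)).real {S | S ⊆ A} ∧
    ∫ S, matNorm .spectral (X - colProj .spectral X S) ^ 2
        ∂(ProbabilityTheory.cond (dpp (firstCols hkr V)) {S | S ⊆ A}) ≤
      ((A.card : ℝ) - k + 1) * (k - 1 + θ) *
        matNorm .spectral (X - bestRank .spectral k X) ^ 2 ∧
    ∫ S, matNorm .frobenius (X - colProj .frobenius X S) ^ 2
        ∂(ProbabilityTheory.cond (dpp (firstCols hkr V)) {S | S ⊆ A}) ≤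
      (1 + flatness d k σ * (((A.card : ℝ) + 1 - k) / (d - k)) * (k - 1 + θ)) *
        matNorm .frobenius (X - bestRank .frobenius k X) ^ 2 := by
  have hprob := one_div_le_det_rowGram (firstCols_orth hkr hX.orthV) hA
  rw [← dpp_real_subset] at hprob
  rw [sub_add_eq_add_sub]
  exact ⟨hprob, hX.integral_cond_spectral_sq_le hk hkr hθ hA,
    hX.integral_cond_frobenius_sq_le hk hkr hθ hA⟩

theorem mainTheorem3 {N d r k : ℕ} (X : Matrix (Fin N) (Fin d) ℝ)
    (U : Matrix (Fin N) (Fin r) ℝ) (σ : Fin r → ℝ) (V : Matrix (Fin d) (Fin r) ℝ)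
    (hX : IsThinSVD X U σ V) (hk : 1 ≤ k) (hkr : k ≤ r)
    (π : Equiv.Perm (Fin d))
    (hπ : Antitone fun i => leverage (firstCols hkr V) (π i))
    (θ : ℝ) (hθ : 1 < θ) :
    1 / θ ≤ (dpp (firstCols hkr V)).real
        (avoidEvent (firstCols hkr V) π θ) ∧
    ∫ S, matNorm .spectral (X - colProj .spectral X S) ^ 2
        ∂(ProbabilityTheory.cond (dpp (firstCols hkr V))
          (avoidEvent (firstCols hkr V) π θ)) ≤
      ((pEff (firstCols hkr V) π θ : ℝ) - k + 1) * (k - 1 + θ) *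
        matNorm .spectral (X - bestRank .spectral k X) ^ 2 ∧
    ∫ S, matNorm .frobenius (X - colProj .frobenius X S) ^ 2
        ∂(ProbabilityTheory.cond (dpp (firstCols hkr V))
          (avoidEvent (firstCols hkr V) π θ)) ≤
      (1 + flatness d k σ *
          (((pEff (firstCols hkr V) π θ : ℝ) + 1 - k) / (d - k)) *
          (k - 1 + θ)) *
        matNorm .frobenius (X - bestRank .frobenius k X) ^ 2 := by
  obtain ⟨hle, hsum⟩ := pEff_spec (firstCols_orth hkr hX.orthV)
    ((hk.trans hkr).trans hX.le_cols) π hθ.le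
  have h := mainTheorem3_general hX hk hkr (zero_lt_one.trans hθ) hsum
  rwa [← avoidEvent_eq, card_compl_tailSet π hle] at h
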